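/- Let $m,d\ge 0$ be integers, let $q_0,q_1,q_2,\dots\in\mathbb R[x]$ be real polynomials with $\deg q_n=n$ for every $n$ (a "bilinear basis", for example $q_n=x^n$), and for $\delta\ge 0$ put $\vec q_\delta(x)=(q_0(x),\dots,q_\delta(x))^T$ and $Q_\delta(x)=\vec q_\delta(x)\,\vec q_\delta(x)^T$, a $(\delta+1)\times(\delta+1)$ polynomial matrix. Put $\delta_1=\lfloor d/2\rfloor$ and $\delta_2=\lfloor (d-1)/2\rfloor$. Let $M(x)$ be a symmetric $m\times m$ matrix whose entries are real polynomials of degree at most $d$. Then $M(x)$ is positive semidefinite for every real $x\ge 0$ if and only if there are positive semidefinite real symmetric matrices $Y_1$, acting on $\mathbb R^{\delta_1+1}\otimes\mathbb R^m$, and $Y_2$, acting on $\mathbb R^{\delta_2+1}\otimes\mathbb R^m$, such that, identically in $x$, $$M(x)=\operatorname{Tr}_{\mathbb R^{\delta_1+1}}\bigl(Y_1\,(Q_{\delta_1}(x)\otimes \mathbf 1_{m\times m})\bigr)+x\,\operatorname{Tr}_{\mathbb R^{\delta_2+1}}\bigl(Y_2\,(Q_{\delta_2}(x)\otimes \mathbf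 1_{m\times m})\bigr),$$ where each trace is the partial trace over the first tensor factor. (For $d=0$ one has $\delta_2=-1$, and the second term is absent.) -/

import Mathlib

open scoped Kronecker

/-- The `k × k` polynomial matrix `q⃗(x) q⃗(x)ᵀ` built from the first `k` members
`q⃗ = (q₀, …, q_{k-1})` of a sequence of polynomials with `deg qᵢ = i`. With `k = δ + 1` this
is `Q_δ(x)`; for `k = 0` (that is, `δ = -1`) it is the empty matrix. -/
noncomputable def bilinearMatrix (q : Polynomial.Sequence ℝ) (k : ℕ) :
    Matrix (Fin k) (Fin k) (Polynomial ℝ) :=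
  Matrix.vecMulVec (fun i : Fin k => q (i : ℕ)) (fun i : Fin k => q (i : ℕ))

/-- The trace over the first tensor factor of a matrix acting on `R^κ ⊗ R^μ`. -/
def partialTrace {κ μ R : Type*} [Fintype κ] [AddCommMonoid R]
    (A : Matrix (κ × μ) (κ × μ) R) : Matrix μ μ R :=
  Matrix.of fun r s => ∑ a : κ, A (a, r) (a, s)

/-- `Tr_{ℝ^k} (Y (Q(x) ⊗ 1))`, a polynomial matrix in `x`, where `Q = q⃗ q⃗ᵀ` is `k × k`, the
identity matrix is `m × m`, and `Y` is a constant real matrix acting on `ℝ^k ⊗ ℝ^m`. -/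
noncomputable def bilinearTrace (q : Polynomial.Sequence ℝ) {k m : ℕ}
    (Y : Matrix (Fin k × Fin m) (Fin k × Fin m) ℝ) :
    Matrix (Fin m) (Fin m) (Polynomial ℝ) :=
  partialTrace (Y.map Polynomial.C *
    (bilinearMatrix q k ⊗ₖ (1 : Matrix (Fin m) (Fin m) (Polynomial ℝ))))

/-- The size `δ₁ + 1` of the first bilinear block, `δ₁ = ⌊d / 2⌋`. -/
def blockSize₁ (d : ℕ) : ℕ := d / 2 + 1

/-- The size `δ₂ + 1` of the second bilinear block, `δ₂ = ⌊(d - 1) / 2⌋`, which is `-1` for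
`d = 0`. -/
def blockSize₂ (d : ℕ) : ℕ := (d + 1) / 2

theorem blockSize₁_eq (d : ℕ) : (blockSize₁ d : ℤ) = ⌊(d : ℚ) / 2⌋ + 1 := by
  have h : ⌊(d : ℚ) / 2⌋ = ((d / 2 : ℕ) : ℤ) := by
    simpa using Rat.floor_intCast_div_natCast (d : ℤ) 2
  rw [h, blockSize₁]
  push_cast
  ring

theorem blockSize₂_eq (d : ℕ) : (blockSize₂ d : ℤ) = ⌊((d : ℚ) - 1) / 2⌋ + 1 := by
  have h : ⌊((d : ℚ) - 1) / 2⌋ = ((d : ℤ) - 1) / 2 := by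
    simpa using Rat.floor_intCast_div_natCast ((d : ℤ) - 1) 2
  rw [h, blockSize₂]
  omega

/-! Substituting x² for x makes M positive semidefinite on all of ℝ, where the matrix Fejér–Riesz
theorem gives M(x²) = BᵀB. Splitting B(x) = E(x²) + x O(x²) and comparing even parts yields M = EᵀE
+ x OᵀO. On the diagonal this is a sum of terms nonnegative for x > 0, so leading terms cannot
cancel and the degree bound passes to E and O. Their coordinates in the basis q then give Y₁ and Y₂
as Gram matrices. The converse is evaluation at x.

Fejér–Riesz is proved over ℂ (`PosOnReal.isGram`) by descent on ∑ e i plus the size, where deg M i i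
≤ 2 e i. If all e i vanish, M is constant and has a square root. Otherwise
`PosOnReal.exists_reducing_vector` finds a new i-th basis vector v. When det M is constant, the
matrix of leading coefficients is singular, and its kernel supplies a v that lowers the degree of
the i-th diagonal entry. When det M has a root z, the kernel of M(z) supplies a v for which column i
is divisible by X - z; dividing out that factor and its conjugate lowers the degree by two. A
diagonal entry that becomes zero takes its row and column with it, and the size drops. -/

section MatrixFejerRiesz

open Polynomial Matrix Filter Topology
open scoped ComplexOrder MatrixOrder Matrix.Norms.L2Operator

/-! ### Scalar polynomials nonnegative on the real line -/

/-- Evaluation of a complex polynomial at a real point. -/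
noncomputable def evalReal (x : ℝ) : ℂ[X] →+* ℂ := evalRingHom (x : ℂ)

/-- Complex conjugation of the coefficients of a polynomial. -/
noncomputable def conjPoly : ℂ[X] →+* ℂ[X] := mapRingHom (starRingEnd ℂ)

theorem evalReal_apply (x : ℝ) (p : ℂ[X]) : evalReal x p = p.eval (x : ℂ) := rfl

theorem evalReal_conjPoly (x : ℝ) (p : ℂ[X]) : evalReal x (conjPoly p) = star (evalReal x p) := by
  have h := Polynomial.eval_map_apply (f := starRingEnd ℂ) (p := p) (x : ℂ)
  rw [Complex.conj_ofReal] at h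
  exact h

theorem coeff_conjPoly (p : ℂ[X]) (n : ℕ) : (conjPoly p).coeff n = star (p.coeff n) := by
  simp [conjPoly]

theorem natDegree_conjPoly_le (p : ℂ[X]) : (conjPoly p).natDegree ≤ p.natDegree :=
  natDegree_map_le

theorem conjPoly_X_sub_C (z : ℂ) : conjPoly (X - C z) = X - C (star z) := by
  simp [conjPoly]

theorem eq_of_evalReal_eq {p q : ℂ[X]} (h : ∀ x : ℝ, evalReal x p = evalReal x q) : p = q := by
  refine Polynomial.eq_of_infinite_eval_eq p q ?_
  refine (Set.infinite_range_of_injective Complex.ofReal_injective).mono ?_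
  rintro _ ⟨x, rfl⟩
  exact h x

theorem continuous_evalReal (p : ℂ[X]) : Continuous fun x : ℝ => evalReal x p := by
  simp only [evalReal_apply]
  fun_prop

theorem evalReal_eq_pow_mul_reflect (p : ℂ[X]) {n : ℕ} (h : p.natDegree ≤ n) {x : ℝ} (hx : x ≠ 0) :
    evalReal x p = evalReal x⁻¹ (p.reflect n) * (x : ℂ) ^ n := by
  have hx' : (x : ℂ) ≠ 0 := by exact_mod_cast hx
  let _ : Invertible (x : ℂ) := invertibleOfNonzero hx'
  have := eval₂_reflect_mul_pow (RingHom.id ℂ) (x : ℂ) n p h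
  rw [invOf_eq_inv] at this
  simp only [evalReal_apply, Complex.ofReal_inv]
  exact this.symm

theorem evalReal_zero_reflect (p : ℂ[X]) (n : ℕ) : evalReal 0 (p.reflect n) = p.coeff n := by
  rw [evalReal_apply, Complex.ofReal_zero, ← coeff_zero_eq_eval_zero, coeff_reflect,
    revAt_le (Nat.zero_le n), Nat.sub_zero]

theorem tendsto_evalReal_div_pow (p : ℂ[X]) {n : ℕ} (h : p.natDegree ≤ n) :
    Tendsto (fun x : ℝ => evalReal x p / (x : ℂ) ^ n) atTop (𝓝 (p.coeff n)) := by
  have h1 : Tendsto (fun x : ℝ => evalReal x⁻¹ (p.reflect n)) atTop (𝓝 (p.coeff n)) := by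
    rw [← evalReal_zero_reflect]
    exact ((continuous_evalReal _).tendsto 0).comp tendsto_inv_atTop_zero
  refine h1.congr' ?_
  filter_upwards [eventually_gt_atTop 0] with x hx
  have hx' : (x : ℂ) ≠ 0 := by exact_mod_cast hx.ne'
  rw [evalReal_eq_pow_mul_reflect p h hx.ne', mul_div_assoc, div_self (pow_ne_zero _ hx'), mul_one]

/-- The leading coefficient of a polynomial that is nonnegative on `[0, ∞)` is nonnegative. -/
theorem coeff_nonneg_of_evalReal_nonneg {p : ℂ[X]} {n : ℕ} (h : p.natDegree ≤ n)
    (hp : ∀ x : ℝ, 0 < x → 0 ≤ evalReal x p) : 0 ≤ p.coeff n := by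
  refine ge_of_tendsto (tendsto_evalReal_div_pow p h) ?_
  filter_upwards [eventually_gt_atTop 0] with x hx
  have hx' : 0 ≤ ((x ^ n)⁻¹ : ℝ) := by positivity
  have h2 : (0 : ℂ) ≤ (((x ^ n)⁻¹ : ℝ) : ℂ) := by exact_mod_cast hx'
  have := mul_nonneg (hp x hx) h2
  simpa [div_eq_mul_inv] using this

/-- A polynomial that is nonnegative on the real line has no odd leading term. -/
theorem coeff_odd_eq_zero_of_nonneg {p : ℂ[X]} {n : ℕ} (hn : Odd n) (h : p.natDegree ≤ n)
    (hp : ∀ x : ℝ, 0 ≤ evalReal x p) : p.coeff n = 0 := by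
  have h1 := coeff_nonneg_of_evalReal_nonneg h fun x _ => hp x
  have h2 : 0 ≤ (p.comp (-X)).coeff n := by
    refine coeff_nonneg_of_evalReal_nonneg ?_ fun x _ => ?_
    · rw [natDegree_comp]; simpa using h
    · have := hp (-x)
      simpa [evalReal_apply] using this
  have hX : (-X : ℂ[X]) = C (-1) * X := by simp
  rw [hX, comp_C_mul_X_coeff, hn.neg_one_pow, mul_neg_one, neg_nonneg] at h2
  exact le_antisymm h2 h1

/-- A real root of a polynomial that is nonnegative on the real line is a double root. -/
theorem sq_dvd_of_nonneg {p : ℂ[X]} (hp : ∀ x : ℝ, 0 ≤ evalReal x p) {t : ℝ}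
    (ht : evalReal t p = 0) : (X - C (t : ℂ)) * (X - C (t : ℂ)) ∣ p := by
  obtain ⟨g, rfl⟩ := dvd_iff_isRoot.2 (show p.IsRoot (t : ℂ) from ht)
  refine mul_dvd_mul_left _ (dvd_iff_isRoot.2 ?_)
  change evalReal t g = 0
  have key : ∀ x : ℝ, evalReal x ((X - C (t : ℂ)) * g) = ((x - t : ℝ) : ℂ) * evalReal x g := by
    intro x; simp [evalReal_apply]
  have hc := continuous_evalReal g
  apply le_antisymm
  · have h1 : Tendsto (fun x : ℝ => evalReal x g) (𝓝[<] t) (𝓝 (evalReal t g)) :=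
      (hc.tendsto t).mono_left nhdsWithin_le_nhds
    refine le_of_tendsto h1 ?_
    filter_upwards [self_mem_nhdsWithin] with x hx
    have h2 := hp x
    rw [key] at h2
    have hx' : x - t < 0 := sub_neg.2 hx
    rw [Complex.le_def] at h2 ⊢
    simp only [Complex.re_ofReal_mul, Complex.im_ofReal_mul, Complex.zero_re, Complex.zero_im] at h2 ⊢
    refine ⟨by nlinarith [h2.1], ?_⟩
    have := h2.2.symm
    rcases mul_eq_zero.1 this with h | h
    · exact absurd h hx'.ne
    · exact h
  · have h1 : Tendsto (fun x : ℝ => evalReal x g) (𝓝[>] t) (𝓝 (evalReal t g)) :=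
      (hc.tendsto t).mono_left nhdsWithin_le_nhds
    refine ge_of_tendsto h1 ?_
    filter_upwards [self_mem_nhdsWithin] with x hx
    have h2 := hp x
    rw [key] at h2
    have hx' : 0 < x - t := sub_pos.2 hx
    rw [Complex.le_def] at h2 ⊢
    simp only [Complex.re_ofReal_mul, Complex.im_ofReal_mul, Complex.zero_re, Complex.zero_im] at h2 ⊢
    refine ⟨by nlinarith [h2.1], ?_⟩
    have := h2.2.symm
    rcases mul_eq_zero.1 this with h | h
    · exact absurd h hx'.ne'
    · exact h.symm

/-- A root `z` of a polynomial that is nonnegative on the real line splits off the quadratic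
factor `(x - z̄) (x - z)`. -/
theorem conj_mul_dvd_of_nonneg {p : ℂ[X]} (hp : ∀ x : ℝ, 0 ≤ evalReal x p) {z : ℂ}
    (hz : X - C z ∣ p) : conjPoly (X - C z) * (X - C z) ∣ p := by
  rw [conjPoly_X_sub_C]
  -- A real root is double; a nonreal root and its conjugate give coprime factors.
  by_cases hr : star z = z
  · obtain ⟨t, rfl⟩ := Complex.conj_eq_iff_real.1 hr
    rw [hr]
    exact sq_dvd_of_nonneg hp (dvd_iff_isRoot.1 hz)
  · have hconj : conjPoly p = p := eq_of_evalReal_eq fun x => by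
      rw [evalReal_conjPoly]
      exact (IsSelfAdjoint.of_nonneg (hp x)).star_eq
    refine IsCoprime.mul_dvd ?_ ?_ hz
    · exact isCoprime_X_sub_C_of_isUnit_sub (sub_ne_zero.2 hr).isUnit
    · rw [← hconj, ← conjPoly_X_sub_C]
      exact map_dvd conjPoly hz

/-! ### Positive semidefinite matrices of complex polynomials -/

variable {ι κ ν : Type}

/-- The conjugate transpose of a matrix of complex polynomials, with respect to the involution that
conjugates coefficients. -/
noncomputable def conjTransposePoly (A : Matrix κ ι ℂ[X]) : Matrix ι κ ℂ[X] :=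
  Aᵀ.map conjPoly

theorem conjTransposePoly_apply (A : Matrix κ ι ℂ[X]) (i : ι) (k : κ) :
    conjTransposePoly A i k = conjPoly (A k i) := rfl

theorem map_conjTransposePoly (A : Matrix κ ι ℂ[X]) (x : ℝ) :
    (conjTransposePoly A).map (evalReal x) = (A.map (evalReal x))ᴴ := by
  ext i j
  simp [conjTransposePoly, evalReal_conjPoly]

theorem conjTransposePoly_mul [Fintype ι] (A : Matrix κ ι ℂ[X]) (B : Matrix ι ν ℂ[X]) :
    conjTransposePoly (A * B) = conjTransposePoly B * conjTransposePoly A := by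
  rw [conjTransposePoly, transpose_mul, Matrix.map_mul]
  rfl

theorem conjTransposePoly_one [DecidableEq ι] :
    conjTransposePoly (1 : Matrix ι ι ℂ[X]) = 1 := by
  simp [conjTransposePoly, Matrix.map_one]

theorem conjTransposePoly_mul_mul_apply [Fintype ι] (M : Matrix ι ι ℂ[X]) (S : Matrix ι κ ℂ[X]) (j k : κ) :
    (conjTransposePoly S * M * S) j k = ∑ a, ∑ b, conjPoly (S a j) * M a b * S b k := by
  simp only [Matrix.mul_apply, Finset.sum_mul, conjTransposePoly_apply]
  exact Finset.sum_comm

/-- A matrix of complex polynomials that is positive semidefinite at every real point. -/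
def PosOnReal (M : Matrix ι ι ℂ[X]) : Prop := ∀ x : ℝ, (M.map (evalReal x)).PosSemidef

/-- A matrix of complex polynomials of the form `A* A`. -/
def IsGram (M : Matrix ι ι ℂ[X]) : Prop :=
  ∃ (κ : Type) (_ : Fintype κ) (A : Matrix κ ι ℂ[X]), M = conjTransposePoly A * A

theorem IsGram.conj [Fintype ι] {M : Matrix ι ι ℂ[X]} (h : IsGram M) (P : Matrix ι κ ℂ[X]) :
    IsGram (conjTransposePoly P * M * P) := by
  obtain ⟨ν, _, A, rfl⟩ := h
  exact ⟨ν, inferInstance, A * P, by simp only [conjTransposePoly_mul, Matrix.mul_assoc]⟩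

theorem PosOnReal.conj [Fintype ι] [Fintype κ] {M : Matrix ι ι ℂ[X]} (h : PosOnReal M) (P : Matrix ι κ ℂ[X]) :
    PosOnReal (conjTransposePoly P * M * P) := by
  intro x
  rw [Matrix.map_mul, Matrix.map_mul, map_conjTransposePoly]
  exact (h x).conjTranspose_mul_mul_same _

theorem PosOnReal.conjPoly_apply {M : Matrix ι ι ℂ[X]} (h : PosOnReal M) (i j : ι) :
    conjPoly (M i j) = M j i :=
  eq_of_evalReal_eq fun x => by
    rw [evalReal_conjPoly]
    exact (h x).isHermitian.apply j i

theorem PosOnReal.diag_nonneg {M : Matrix ι ι ℂ[X]} (h : PosOnReal M) (i : ι) (x : ℝ) :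
    0 ≤ evalReal x (M i i) := (h x).diag_nonneg

/-- The 2 × 2 minor on i, j is nonnegative on ℝ. An off-diagonal entry of too large a degree n would
dominate it, with top coefficient -|c|² where c is the leading coefficient of M i j. -/
theorem PosOnReal.natDegree_apply_le {M : Matrix ι ι ℂ[X]} (h : PosOnReal M) {e : ι → ℕ}
    (he : ∀ i, (M i i).natDegree ≤ 2 * e i) (i j : ι) : (M i j).natDegree ≤ e i + e j := by
  by_contra hlt
  push Not at hlt
  set n := (M i j).natDegree with hn
  have hji : (M j i).natDegree ≤ n := by
    rw [← h.conjPoly_apply i j]; exact natDegree_conjPoly_le _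
  set p := M i i * M j j - M i j * M j i with hp
  have hdiag : (M i i * M j j).natDegree < n + n :=
    (natDegree_mul_le_of_le (he i) (he j)).trans_lt (by omega)
  have hcoeff : p.coeff (n + n) = - (M i j).coeff n * star ((M i j).coeff n) := by
    rw [hp, coeff_sub, coeff_eq_zero_of_natDegree_lt hdiag,
      coeff_mul_add_eq_of_natDegree_le le_rfl hji, ← h.conjPoly_apply i j, coeff_conjPoly]
    ring
  have hnonneg : 0 ≤ p.coeff (n + n) := by
    refine coeff_nonneg_of_evalReal_nonneg ?_ fun x _ => ?_
    · exact (natDegree_sub_le _ _).trans (max_le hdiag.le (natDegree_mul_le_of_le le_rfl hji))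
    · have := ((h x).submatrix ![i, j]).det_nonneg
      rw [det_fin_two] at this
      simpa [hp] using this
  rw [hcoeff, neg_mul, neg_nonneg] at hnonneg
  have h0 : (M i j).coeff n * star ((M i j).coeff n) = 0 :=
    le_antisymm hnonneg (mul_star_self_nonneg _)
  have h1 : (M i j).coeff n = 0 := by simpa using h0
  rw [hn, coeff_natDegree, leadingCoeff_eq_zero] at h1
  rw [h1, natDegree_zero] at hn
  omega

theorem PosOnReal.row_eq_zero {M : Matrix ι ι ℂ[X]} (h : PosOnReal M) {i : ι} (hi : M i i = 0)
    (j : ι) : M i j = 0 := by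
  refine eq_of_evalReal_eq fun x => ?_
  have h1 := ((h x).submatrix ![i, j]).det_nonneg
  rw [det_fin_two] at h1
  have h2 : 0 ≤ - (evalReal x (M i j) * star (evalReal x (M i j))) := by
    rw [← evalReal_conjPoly, h.conjPoly_apply]
    simpa [hi] using h1
  have h0 : evalReal x (M i j) * star (evalReal x (M i j)) = 0 :=
    le_antisymm (neg_nonneg.1 h2) (mul_star_self_nonneg _)
  simpa using h0

/-- Positive semidefiniteness extends over one exceptional point by continuity. -/
theorem posOnReal_of_ne [Fintype ι] {M : Matrix ι ι ℂ[X]} (z : ℂ)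
    (h : ∀ x : ℝ, (x : ℂ) ≠ z → (M.map (evalReal x)).PosSemidef) : PosOnReal M := by
  intro x
  have hd : Dense {y : ℝ | (y : ℂ) ≠ z} := by
    refine (dense_compl_singleton z.re).mono ?_
    intro y hy hyz
    exact hy (by rw [← hyz]; simp)
  have hcont : ∀ i j, Continuous fun y : ℝ => evalReal y (M i j) :=
    fun i j => continuous_evalReal _
  have hcl : IsClosed {y : ℝ | (M.map (evalReal y)).PosSemidef} := by
    simp only [posSemidef_iff_dotProduct_mulVec, Set.ofPred_and, Set.ofPred_forall]
    refine IsClosed.inter ?_ (isClosed_iInter fun v => ?_)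
    · refine isClosed_eq ?_ ?_
      · exact continuous_matrix fun i j => by
          simpa using (hcont j i).star
      · exact continuous_matrix fun i j => by simpa using hcont i j
    · refine isClosed_le continuous_const ?_
      simp only [dotProduct, mulVec, Matrix.map_apply]
      exact continuous_finsetSum _ fun i _ => continuous_const.mul
        (continuous_finsetSum _ fun j _ => (hcont i j).mul continuous_const)
  have : closure {y : ℝ | (y : ℂ) ≠ z} ⊆ {y : ℝ | (M.map (evalReal y)).PosSemidef} :=
    hcl.closure_subset_iff.2 fun y hy => h y hy
  exact this (hd x)

/-- Scaling row i by x^(-e i) and column j by x^(-e j) makes M(x) converge to the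
leading-coefficient matrix, while the determinant becomes a constant over x^(2N) with N > 0. -/
theorem PosOnReal.det_coeff_eq_zero [Fintype ι] [DecidableEq ι] {M : Matrix ι ι ℂ[X]}
    (h : PosOnReal M) {e : ι → ℕ} (he : ∀ i, (M i i).natDegree ≤ 2 * e i) (hpos : 0 < ∑ i, e i)
    (hdet : M.det.natDegree = 0) :
    (Matrix.of fun i j => (M i j).coeff (e i + e j)).det = 0 := by
  set N := ∑ i, e i with hN
  have hlim : Tendsto (fun x : ℝ => Matrix.of fun i j => evalReal x (M i j) / (x : ℂ) ^ (e i + e j))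
      atTop (𝓝 (Matrix.of fun i j => (M i j).coeff (e i + e j))) :=
    tendsto_pi_nhds.2 fun i => tendsto_pi_nhds.2 fun j =>
      tendsto_evalReal_div_pow _ (h.natDegree_apply_le he i j)
  have hdetlim := ((continuous_id.matrix_det).tendsto _).comp hlim
  have h0 := tendsto_evalReal_div_pow M.det (n := N + N) (by omega)
  rw [coeff_eq_zero_of_natDegree_lt (by omega)] at h0
  refine tendsto_nhds_unique hdetlim (h0.congr fun x => ?_)
  have hprod : ∏ i, ((x : ℂ) ^ e i)⁻¹ = ((x : ℂ) ^ N)⁻¹ := by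
    rw [Finset.prod_inv_distrib, Finset.prod_pow_eq_pow_sum]
  have hmat : (Matrix.of fun i j => evalReal x (M i j) / (x : ℂ) ^ (e i + e j)) =
      Matrix.of fun i j => ((x : ℂ) ^ e i)⁻¹ *
        (Matrix.of fun i j => ((x : ℂ) ^ e j)⁻¹ * M.map (evalReal x) i j) i j := by
    ext i j
    simp only [Matrix.of_apply, Matrix.map_apply, pow_add, div_eq_mul_inv, mul_inv]
    ring
  have hev : evalReal x M.det = (M.map (evalReal x)).det := RingHom.map_det _ _
  simp only [Function.comp, id]
  rw [hmat, det_mul_column, det_mul_row, hprod, hev, pow_add]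
  simp only [div_eq_mul_inv, mul_inv]
  ring

/-! ### Reducing vectors -/

/-- The Hermitian form `v* M v` attached to a matrix of polynomials. -/
noncomputable def hermForm [Fintype ι] (M : Matrix ι ι ℂ[X]) (v : ι → ℂ[X]) : ℂ[X] :=
  ∑ a, ∑ b, conjPoly (v a) * M a b * v b

theorem natDegree_hermForm_le [Fintype ι] {M : Matrix ι ι ℂ[X]} {e : ι → ℕ}
    (hM : ∀ i j, (M i j).natDegree ≤ e i + e j) {v : ι → ℂ[X]} {n : ℕ}
    (hv : ∀ j, v j ≠ 0 → (v j).natDegree + e j ≤ n) : (hermForm M v).natDegree ≤ 2 * n := by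
  refine natDegree_sum_le_of_forall_le _ _ fun a _ => natDegree_sum_le_of_forall_le _ _ fun b _ => ?_
  by_cases ha : v a = 0
  · simp [ha]
  by_cases hb : v b = 0
  · simp [hb]
  have h1 := natDegree_mul_le_of_le
    (natDegree_mul_le_of_le (natDegree_conjPoly_le (v a)) (hM a b)) (le_refl (v b).natDegree)
  have := hv a ha
  have := hv b hb
  omega

theorem coeff_hermForm [Fintype ι] {M : Matrix ι ι ℂ[X]} {e : ι → ℕ}
    (hM : ∀ i j, (M i j).natDegree ≤ e i + e j) {c : ι → ℂ} {n : ℕ}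
    (hc : ∀ j, c j ≠ 0 → e j ≤ n) :
    (hermForm M fun j => C (c j) * X ^ (n - e j)).coeff (2 * n) =
      star c ⬝ᵥ ((Matrix.of fun i j => (M i j).coeff (e i + e j)) *ᵥ c) := by
  simp only [hermForm, finsetSum_coeff, dotProduct, mulVec, Finset.mul_sum]
  refine Finset.sum_congr rfl fun a _ => Finset.sum_congr rfl fun b _ => ?_
  by_cases ha : c a = 0
  · simp [ha]
  by_cases hb : c b = 0
  · simp [hb]
  have h1 := hc a ha
  have h2 := hc b hb
  have hdeg : 2 * n = ((n - e a) + (e a + e b)) + (n - e b) := by omega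
  have hva : (conjPoly (C (c a) * X ^ (n - e a))).natDegree ≤ n - e a :=
    (natDegree_conjPoly_le _).trans (natDegree_C_mul_X_pow_le _ _)
  rw [hdeg, coeff_mul_add_eq_of_natDegree_le (natDegree_mul_le_of_le hva (hM a b))
    (natDegree_C_mul_X_pow_le _ _), coeff_mul_add_eq_of_natDegree_le hva (hM a b), coeff_conjPoly]
  simp [mul_assoc]

theorem exists_support_max {e : ι → ℕ} [Finite ι] {c : ι → ℂ} (hc : c ≠ 0) :
    ∃ i, c i ≠ 0 ∧ ∀ j, c j ≠ 0 → e j ≤ e i := by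
  obtain ⟨i0, hi0⟩ := Function.ne_iff.1 hc
  obtain ⟨i, hi, hmax⟩ := (Set.toFinite {j | c j ≠ 0}).exists_maximalFor e _ ⟨i0, hi0⟩
  refine ⟨i, hi, fun j hj => ?_⟩
  rcases le_total (e i) (e j) with h | h
  · exact hmax hj h
  · exact h

/-- As long as the degree bounds are not all zero, a unimodular change of one basis vector either
kills a leading coefficient on the diagonal or makes a column divisible by a linear factor. -/
theorem PosOnReal.exists_reducing_vector [Fintype ι] [DecidableEq ι] {M : Matrix ι ι ℂ[X]}
    (h : PosOnReal M) {e : ι → ℕ} (he : ∀ i, (M i i).natDegree ≤ 2 * e i)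
    (hpos : 0 < ∑ i, e i) :
    ∃ (i : ι) (v : ι → ℂ[X]), v i = 1 ∧ (hermForm M v).natDegree ≤ 2 * e i ∧
      ((hermForm M v).coeff (2 * e i) = 0 ∨ ∃ z : ℂ, ∀ a, X - C z ∣ (M *ᵥ v) a) := by
  have hM := h.natDegree_apply_le he
  by_cases hdet : M.det.natDegree = 0
  · obtain ⟨c, hc, hLc⟩ := exists_mulVec_eq_zero_iff.2 (h.det_coeff_eq_zero he hpos hdet)
    -- Maximality of e i on the support keeps the exponents e i - e j from truncating and bounds the
    -- new diagonal degree by 2 e i.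
    obtain ⟨i, hi, hmax⟩ := exists_support_max (e := e) hc
    have hmax' : ∀ j, ((c i)⁻¹ • c) j ≠ 0 → e j ≤ e i := fun j hj =>
      hmax j fun h0 => hj (by simp [h0])
    refine ⟨i, fun j => C (((c i)⁻¹ • c) j) * X ^ (e i - e j), by simp [hi],
      natDegree_hermForm_le hM fun j hj => ?_, Or.inl ?_⟩
    · have h1 := hmax' j fun h0 => hj (by simp only [h0, map_zero, zero_mul])
      have h2 := natDegree_C_mul_X_pow_le (((c i)⁻¹ • c) j) (e i - e j)
      omega
    · rw [coeff_hermForm hM hmax', mulVec_smul, hLc, smul_zero, dotProduct_zero]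
  · obtain ⟨z, hz⟩ := Complex.exists_root (natDegree_pos_iff_degree_pos.1 (Nat.pos_of_ne_zero hdet))
    have hz' : (M.map (evalRingHom z)).det = 0 := by
      rw [← RingHom.mapMatrix_apply, ← RingHom.map_det]; exact hz
    obtain ⟨c, hc, hLc⟩ := exists_mulVec_eq_zero_iff.2 hz'
    obtain ⟨i, hi, hmax⟩ := exists_support_max (e := e) hc
    refine ⟨i, fun j => C (((c i)⁻¹ • c) j), by simp [hi],
      natDegree_hermForm_le hM fun j hj => ?_, Or.inr ⟨z, fun a => dvd_iff_isRoot.2 ?_⟩⟩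
    · rw [natDegree_C, zero_add]
      exact hmax j fun h0 => hj (by simp [h0])
    · have h1 : (M.map (evalRingHom z) *ᵥ ((c i)⁻¹ • c)) a = 0 := by
        rw [mulVec_smul, hLc, smul_zero, Pi.zero_apply]
      rw [IsRoot, ← h1]
      simp [mulVec, dotProduct, eval_finsetSum]

/-! ### Congruences that change one basis vector -/

theorem hermForm_updateCol [Fintype ι] [DecidableEq ι] (M : Matrix ι ι ℂ[X]) (i : ι)
    (v : ι → ℂ[X]) :
    (conjTransposePoly (updateCol 1 i v) * M * updateCol 1 i v) i i = hermForm M v := by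
  simp [conjTransposePoly_mul_mul_apply, hermForm]

theorem conj_updateCol_apply_of_ne [Fintype ι] [DecidableEq ι] (M : Matrix ι ι ℂ[X]) {i j : ι}
    (hj : j ≠ i) (v : ι → ℂ[X]) :
    (conjTransposePoly (updateCol 1 i v) * M * updateCol 1 i v) j j = M j j := by
  simp [conjTransposePoly_mul_mul_apply, updateCol_ne hj, Matrix.one_apply, apply_ite conjPoly]

theorem dvd_conj_updateCol [Fintype ι] [DecidableEq ι] {M : Matrix ι ι ℂ[X]} {i : ι}
    {v : ι → ℂ[X]} {p : ℂ[X]} (hp : ∀ a, p ∣ (M *ᵥ v) a) (j : ι) :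
    p ∣ (conjTransposePoly (updateCol 1 i v) * M * updateCol 1 i v) j i := by
  rw [Matrix.mul_assoc, Matrix.mul_apply]
  refine Finset.dvd_sum fun a _ => Dvd.dvd.mul_left ?_ _
  have : (M * updateCol 1 i v) a i = (M *ᵥ v) a := by
    simp [Matrix.mul_apply, mulVec, dotProduct]
  rw [this]
  exact hp a

/-- The change of basis has determinant v i = 1, so its inverse is again polynomial. -/
theorem isGram_of_conj_updateCol [Fintype ι] [DecidableEq ι] {M : Matrix ι ι ℂ[X]} {i : ι}
    {v : ι → ℂ[X]} (hv : v i = 1)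
    (h : IsGram (conjTransposePoly (updateCol 1 i v) * M * updateCol 1 i v)) : IsGram M := by
  have hdet : (updateCol (1 : Matrix ι ι ℂ[X]) i v).det = 1 := by
    rw [← cramer_apply, cramer_one]; exact hv
  have hmul := mul_nonsing_inv (updateCol (1 : Matrix ι ι ℂ[X]) i v) (by simp [hdet])
  have h1 := h.conj (updateCol (1 : Matrix ι ι ℂ[X]) i v)⁻¹
  have h2 := congrArg conjTransposePoly hmul
  rw [conjTransposePoly_mul, conjTransposePoly_one] at h2
  rwa [Matrix.mul_assoc _ _ (updateCol 1 i v)⁻¹, Matrix.mul_assoc _ _ (updateCol 1 i v)⁻¹, hmul,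
    Matrix.mul_one, ← Matrix.mul_assoc, h2, Matrix.one_mul] at h1

theorem isGram_of_row_eq_zero [Fintype ι] [DecidableEq ι] {M : Matrix ι ι ℂ[X]} {i : ι}
    (hM : ∀ j, M i j = 0) (hM' : ∀ j, M j i = 0)
    (h : IsGram (M.submatrix (Subtype.val : {j // j ≠ i} → ι) Subtype.val)) : IsGram M := by
  have h1 := h.conj (Matrix.of fun (a : {j // j ≠ i}) (j : ι) => if a.1 = j then (1 : ℂ[X]) else 0)
  convert h1 using 1
  ext1 j k
  rw [conjTransposePoly_mul_mul_apply]
  by_cases hj : j = i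
  · subst hj
    rw [hM, Finset.sum_eq_zero]
    intro a _
    simp [a.2]
  by_cases hk : k = i
  · subst hk
    rw [hM', Finset.sum_eq_zero]
    intro a _
    rw [Finset.sum_eq_zero]
    intro b _
    simp [b.2]
  rw [Finset.sum_eq_single ⟨j, hj⟩, Finset.sum_eq_single ⟨k, hk⟩]
  · simp
  · intro b _ hb
    have : b.1 ≠ k := fun h => hb (Subtype.ext h)
    simp [this]
  · simp
  · intro a _ ha
    have : a.1 ≠ j := fun h => ha (Subtype.ext h)
    simp [this]
  · simp

/-- A column divisible by a linear factor can be divided by it, together with the conjugate row. -/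
theorem PosOnReal.exists_eq_conj_diagonal [Fintype ι] [DecidableEq ι] {M : Matrix ι ι ℂ[X]}
    (h : PosOnReal M) {i : ι} {z : ℂ} (hz : ∀ j, X - C z ∣ M j i) :
    ∃ M' : Matrix ι ι ℂ[X], PosOnReal M' ∧ (∀ j, j ≠ i → M' j j = M j j) ∧
      M i i = conjPoly (X - C z) * (X - C z) * M' i i ∧
      M = conjTransposePoly (diagonal fun j => if j = i then X - C z else 1) * M' *
        (diagonal fun j => if j = i then X - C z else 1) := by
  choose r hr using hz
  obtain ⟨g, hg⟩ := conj_mul_dvd_of_nonneg (h.diag_nonneg i) (z := z) ⟨r i, hr i⟩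
  set D : Matrix ι ι ℂ[X] := diagonal fun j => if j = i then X - C z else 1 with hD
  set M' : Matrix ι ι ℂ[X] := Matrix.of fun j k =>
    if j = i then (if k = i then g else conjPoly (r k)) else if k = i then r j else M j k with hM'
  have hDconj : conjTransposePoly D =
      diagonal fun j => conjPoly (if j = i then X - C z else 1) := by
    rw [conjTransposePoly, hD, diagonal_transpose, diagonal_map (map_zero _)]
  have hfac : M = conjTransposePoly D * M' * D := by
    ext1 j k
    rw [hDconj, hD, mul_diagonal, diagonal_mul]
    by_cases hj : j = i
    · by_cases hk : k = i
      · subst hj hk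
        simp only [hM', Matrix.of_apply, if_true, hg]
        ring
      · have := h.conjPoly_apply k i
        rw [hr k, map_mul] at this
        subst hj
        simp [hM', hk, ← this]
    · by_cases hk : k = i
      · subst hk
        simp only [hM', Matrix.of_apply, hj, if_true, if_false, hr j, map_one]
        ring
      · simp [hM', hj, hk]
  -- Away from z the diagonal factor is invertible, so positivity passes to M'; continuity covers z
  -- itself if it is real.
  refine ⟨M', posOnReal_of_ne z fun x hx => ?_, fun j hj => ?_, ?_, hfac⟩
  · have hDu : IsUnit (D.map (evalReal x)) := by
      rw [isUnit_iff_isUnit_det, hD, diagonal_map (map_zero _), det_diagonal, isUnit_iff_ne_zero,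
        Finset.prod_ne_zero_iff]
      intro j _
      split_ifs
      · simpa [evalReal_apply, sub_eq_zero] using hx
      · simp
    have h1 := h x
    rw [hfac, Matrix.map_mul, Matrix.map_mul, map_conjTransposePoly] at h1
    exact (hDu.posSemidef_star_left_conjugate_iff).1 h1
  · simp [hM', hj]
  · simp [hM', hg]

/-! ### The descent -/

theorem PosOnReal.isGram_of_natDegree_eq_zero [Fintype ι] {M : Matrix ι ι ℂ[X]}
    (h : PosOnReal M) (h0 : ∀ i j, (M i j).natDegree = 0) : IsGram M := by
  classical
  obtain ⟨B, hB⟩ := CStarAlgebra.nonneg_iff_eq_star_mul_self.1 (h 0).nonneg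
  refine ⟨ι, inferInstance, B.map C, ?_⟩
  have hM : M = (M.map (evalReal 0)).map C := by
    ext1 i j
    conv_lhs => rw [eq_C_of_natDegree_eq_zero (h0 i j)]
    simp [evalReal_apply, coeff_zero_eq_eval_zero]
  rw [hM, hB, Matrix.map_mul]
  congr 1
  ext1 i j
  simp [conjTransposePoly, conjPoly]

theorem PosOnReal.isGram_of_le (N : ℕ) : ∀ {ι : Type} [Fintype ι] {M : Matrix ι ι ℂ[X]}
    {e : ι → ℕ}, PosOnReal M → (∀ i, (M i i).natDegree ≤ 2 * e i) →
    ∑ i, e i + Fintype.card ι ≤ N → IsGram M := by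
  induction N with
  | zero =>
    intro ι _ M e h _ hN
    have : IsEmpty ι := Fintype.card_eq_zero_iff.1 (by omega)
    exact h.isGram_of_natDegree_eq_zero fun i => isEmptyElim i
  | succ N ih =>
    intro ι _ M e h he hN
    classical
    rcases Nat.eq_zero_or_pos (∑ i, e i) with h0 | hpos
    · refine h.isGram_of_natDegree_eq_zero fun i j => ?_
      have := h.natDegree_apply_le he i j
      simp only [Finset.sum_eq_zero_iff, Finset.mem_univ, true_imp_iff] at h0
      simpa [h0] using this
    obtain ⟨i, v, hv, hdeg, hred⟩ := h.exists_reducing_vector he hpos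
    -- a matrix whose `i`-th diagonal entry has smaller degree is covered by the induction hypothesis
    have step : ∀ M' : Matrix ι ι ℂ[X], PosOnReal M' → (∀ j, j ≠ i → M' j j = M j j) →
        (M' i i = 0 ∨ 0 < e i ∧ (M' i i).natDegree ≤ 2 * (e i - 1)) → IsGram M' := by
      intro M' hpos' hne hi
      have hsum : ∑ j, e j = e i + ∑ j ∈ Finset.univ.erase i, e j :=
        (Finset.add_sum_erase _ _ (Finset.mem_univ i)).symm
      rcases hi with hi | ⟨hei, hi⟩
      · refine isGram_of_row_eq_zero (i := i) (hpos'.row_eq_zero hi)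
          (fun j => by rw [← hpos'.conjPoly_apply i j, hpos'.row_eq_zero hi j, map_zero]) ?_
        refine ih (e := fun j => e j.1) (fun x => (hpos' x).submatrix _) (fun j => ?_) ?_
        · simpa [hne j.1 j.2] using he j.1
        · have h1 : ∑ j ∈ Finset.univ.erase i, e j = ∑ j : {j // j ≠ i}, e j.1 :=
            Finset.sum_subtype _ (by simp) e
          have h2 : Fintype.card {j // j ≠ i} = Fintype.card ι - 1 := by simp
          have h3 : 0 < Fintype.card ι := Fintype.card_pos_iff.2 ⟨i⟩
          omega
      · refine ih (e := Function.update e i (e i - 1)) hpos' (fun j => ?_) ?_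
        · by_cases hj : j = i
          · subst hj; simpa using hi
          · simpa [hj, hne j hj] using he j
        · rw [Finset.sum_update_of_mem (Finset.mem_univ i), ← Finset.erase_eq]
          omega
    refine isGram_of_conj_updateCol hv ?_
    have hposT := h.conj (updateCol 1 i v)
    have hform := hermForm_updateCol M i v
    have hneT := fun j (hj : j ≠ i) => conj_updateCol_apply_of_ne M hj v
    have hdvdT := fun z (hz : ∀ a, X - C z ∣ (M *ᵥ v) a) => dvd_conj_updateCol (i := i) hz
    set T := conjTransposePoly (updateCol 1 i v) * M * updateCol 1 i v
    rw [← hform] at hdeg hred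
    rcases hred with hc | ⟨z, hz⟩
    · refine step T hposT hneT ?_
      rcases Nat.eq_zero_or_pos (e i) with hei | hei
      · left
        rw [hei, mul_zero] at hdeg hc
        rw [eq_C_of_natDegree_le_zero hdeg, hc, C_0]
      · refine Or.inr ⟨hei, natDegree_le_iff_coeff_eq_zero.2 fun n hn => ?_⟩
        -- With the top coefficient gone, the next one has odd degree and must vanish too: the
        -- degree falls by two.
        have hodd : (T i i).coeff (2 * e i - 1) = 0 := by
          refine coeff_odd_eq_zero_of_nonneg ⟨e i - 1, by omega⟩ ?_ (hposT.diag_nonneg i)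
          refine natDegree_le_iff_coeff_eq_zero.2 fun k hk => ?_
          rcases eq_or_ne k (2 * e i) with rfl | hk'
          · exact hc
          · exact coeff_eq_zero_of_natDegree_lt (by omega)
        rcases lt_trichotomy n (2 * e i) with hlt | rfl | hgt
        · rwa [show n = 2 * e i - 1 by omega]
        · exact hc
        · exact coeff_eq_zero_of_natDegree_lt (by omega)
    · obtain ⟨M', hM', hne', hii, hfac⟩ := hposT.exists_eq_conj_diagonal (hdvdT z hz)
      rw [hfac]
      refine (step M' hM' (fun j hj => (hne' j hj).trans (hneT j hj)) ?_).conj _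
      by_cases h0 : M' i i = 0
      · exact Or.inl h0
      -- The quadratic factor uses up two degrees, which also forces e i > 0.
      · have hq : conjPoly (X - C z) * (X - C z) ≠ 0 := by
          rw [conjPoly_X_sub_C]; exact mul_ne_zero (X_sub_C_ne_zero _) (X_sub_C_ne_zero _)
        rw [hii, natDegree_mul hq h0, conjPoly_X_sub_C,
          natDegree_mul (X_sub_C_ne_zero _) (X_sub_C_ne_zero _), natDegree_X_sub_C,
          natDegree_X_sub_C] at hdeg
        exact Or.inr ⟨by omega, by omega⟩

/-- **Matrix Fejér–Riesz theorem** on the real line: a positive semidefinite matrix of complex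
polynomials is of the form `A* A`. -/
theorem PosOnReal.isGram [Fintype ι] {M : Matrix ι ι ℂ[X]} (h : PosOnReal M) : IsGram M :=
  h.isGram_of_le (e := fun i => (M i i).natDegree) _ (fun _ => by omega) le_rfl

/-! ### From complex to real factors -/

theorem evalReal_map_ofReal (x : ℝ) (p : ℝ[X]) :
    evalReal x (p.map Complex.ofRealHom) = ((p.eval x : ℝ) : ℂ) := by
  rw [evalReal_apply]
  exact Polynomial.eval_map_apply (f := Complex.ofRealHom) (p := p) x

theorem conjPoly_map_ofReal (p : ℝ[X]) :
    conjPoly (p.map Complex.ofRealHom) = p.map Complex.ofRealHom := by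
  ext n
  rw [coeff_conjPoly, coeff_map]
  exact Complex.conj_ofReal _

theorem exists_eq_map_add_I_mul_map (p : ℂ[X]) : ∃ a b : ℝ[X],
    p = a.map Complex.ofRealHom + C Complex.I * b.map Complex.ofRealHom := by
  induction p using Polynomial.induction_on' with
  | add p q hp hq =>
    obtain ⟨a, b, rfl⟩ := hp
    obtain ⟨a', b', rfl⟩ := hq
    exact ⟨a + a', b + b', by simp only [Polynomial.map_add]; ring⟩
  | monomial n c =>
    refine ⟨monomial n c.re, monomial n c.im, ?_⟩
    rw [map_monomial, map_monomial, C_mul_monomial, ← map_add (monomial n)]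
    congr 1
    simp [mul_comm Complex.I]

theorem eq_of_map_eq_map_add_I_mul_map {p a b : ℝ[X]} (h : p.map Complex.ofRealHom =
    a.map Complex.ofRealHom + C Complex.I * b.map Complex.ofRealHom) : p = a := by
  ext n
  have := congrArg Complex.re (congrArg (fun f => coeff f n) h)
  simpa using this

theorem posSemidef_map_ofReal [Fintype ι] {A : Matrix ι ι ℝ} (h : A.PosSemidef) :
    (A.map ((↑) : ℝ → ℂ)).PosSemidef := by
  classical
  obtain ⟨B, rfl⟩ := CStarAlgebra.nonneg_iff_eq_star_mul_self.1 h.nonneg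
  have : (star B * B).map ((↑) : ℝ → ℂ) = (B.map ((↑) : ℝ → ℂ))ᴴ * B.map ((↑) : ℝ → ℂ) := by
    ext i j
    simp [Matrix.mul_apply, star_eq_conjTranspose]
  rw [this]
  exact posSemidef_conjTranspose_mul_self _

/-- **Matrix Fejér–Riesz theorem** on the real line, for real polynomials: a positive semidefinite
matrix is a sum of squares. -/
theorem exists_eq_transpose_mul_self [Fintype ι] {N : Matrix ι ι ℝ[X]}
    (h : ∀ x : ℝ, (N.map (eval x)).PosSemidef) :
    ∃ (κ : Type) (_ : Fintype κ) (B : Matrix κ ι ℝ[X]), N = Bᵀ * B := by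
  have hpos : PosOnReal (N.map (Polynomial.map Complex.ofRealHom)) := by
    intro x
    convert posSemidef_map_ofReal (h x) using 1
    ext i j
    simp [evalReal_map_ofReal]
  obtain ⟨κ, _, A, hA⟩ := hpos.isGram
  choose P Q hPQ using fun r j => exists_eq_map_add_I_mul_map (A r j)
  -- For A = P + iQ, the real part of A*A is PᵀP + QᵀQ, so P is stacked on Q.
  refine ⟨κ ⊕ κ, inferInstance, Matrix.of (Sum.elim P Q), ?_⟩
  ext1 i j
  have hij := congrFun (congrFun hA i) j
  simp only [Matrix.map_apply, Matrix.mul_apply, conjTransposePoly_apply] at hij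
  simp only [Matrix.mul_apply, Matrix.transpose_apply, Fintype.sum_sum_type, Matrix.of_apply,
    Sum.elim_inl, Sum.elim_inr]
  refine eq_of_map_eq_map_add_I_mul_map (b := ∑ r, (P r i * Q r j - Q r i * P r j)) ?_
  rw [hij]
  simp only [Polynomial.map_add, Polynomial.map_sum, Polynomial.map_mul, Polynomial.map_sub,
    Finset.mul_sum, ← Finset.sum_add_distrib]
  refine Finset.sum_congr rfl fun r _ => ?_
  have hI : (C Complex.I * C Complex.I : ℂ[X]) = -1 := by
    rw [← C_mul, Complex.I_mul_I, C_neg, C_1]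
  have hcI : conjPoly (C Complex.I) = -C Complex.I := by
    rw [← C_neg]; ext n; rw [coeff_conjPoly, coeff_C, coeff_C]; split_ifs <;> simp
  rw [hPQ r i, hPQ r j, map_add, map_mul, conjPoly_map_ofReal, conjPoly_map_ofReal, hcI]
  linear_combination (-(Q r i).map Complex.ofRealHom * (Q r j).map Complex.ofRealHom) * hI

/-! ### Even and odd parts: the half-line -/

theorem contract_two_X_mul_expand (g : ℝ[X]) : contract 2 (X * expand ℝ 2 g) = 0 := by
  ext n
  rw [coeff_contract two_ne_zero, coeff_zero]
  rcases n with _ | n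
  · simp
  · rw [show (n + 1) * 2 = (2 * n + 1) + 1 by ring, coeff_X_mul, coeff_expand two_pos,
      if_neg (by omega)]

theorem expand_contract_two_add (p : ℝ[X]) :
    expand ℝ 2 (contract 2 p) + X * expand ℝ 2 (contract 2 p.divX) = p := by
  ext n
  rw [coeff_add]
  rcases n with _ | n
  · simp [coeff_expand two_pos, coeff_contract two_ne_zero]
  · rw [coeff_X_mul, coeff_expand two_pos, coeff_expand two_pos, coeff_contract two_ne_zero,
      coeff_contract two_ne_zero, coeff_divX]
    rcases Nat.even_or_odd' n with ⟨k, rfl | rfl⟩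
    · rw [if_neg (by omega), if_pos (by omega), zero_add]
      congr 1; omega
    · rw [if_pos (by omega), if_neg (by omega), add_zero]
      congr 1; omega

/-- **Matrix Fejér–Riesz theorem** on the half-line. -/
theorem exists_eq_transpose_mul_self_add_X_smul [Fintype ι] {M : Matrix ι ι ℝ[X]}
    (h : ∀ x : ℝ, 0 ≤ x → (M.map (eval x)).PosSemidef) :
    ∃ (κ : Type) (_ : Fintype κ) (E O : Matrix κ ι ℝ[X]),
      M = Eᵀ * E + (X : ℝ[X]) • (Oᵀ * O) := by
  obtain ⟨κ, _, B, hB⟩ := exists_eq_transpose_mul_self (N := M.map (expand ℝ 2)) fun x => by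
    convert h (x ^ 2) (sq_nonneg x) using 1
    ext i j
    simp [expand_eval]
  refine ⟨κ, inferInstance, B.map (contract 2), B.map fun p => contract 2 p.divX, ?_⟩
  ext1 i j
  have hij := congrFun (congrFun hB i) j
  set E : κ → ι → ℝ[X] := fun r j => contract 2 (B r j) with hE
  set O : κ → ι → ℝ[X] := fun r j => contract 2 (B r j).divX with hO
  have hexp : expand ℝ 2 (M i j) =
      expand ℝ 2 (∑ r, E r i * E r j + X * ∑ r, O r i * O r j) +
        X * expand ℝ 2 (∑ r, (E r i * O r j + O r i * E r j)) := by
    rw [Matrix.map_apply, Matrix.mul_apply] at hij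
    rw [hij]
    simp only [map_add, map_mul, map_sum, expand_X, Finset.mul_sum, ← Finset.sum_add_distrib]
    refine Finset.sum_congr rfl fun r _ => ?_
    have hBr : ∀ j, B r j = expand ℝ 2 (E r j) + X * expand ℝ 2 (O r j) :=
      fun j => (expand_contract_two_add _).symm
    rw [Matrix.transpose_apply, hBr i, hBr j]
    ring
  -- `contract 2` discards the odd cross terms and undoes x ↦ x² on the rest.
  have := congrArg (contract 2) hexp
  rw [contract_add two_ne_zero, contract_two_X_mul_expand, add_zero, contract_expand 2 two_ne_zero,
    contract_expand 2 two_ne_zero] at this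
  rw [this]
  simp [Matrix.mul_apply, hE, hO]

/-! ### Degree bounds for the factors -/

theorem natDegree_le_of_eval_le {s p : ℝ[X]} (hs : ∀ x : ℝ, 0 < x → 0 ≤ s.eval x)
    (h : ∀ x : ℝ, 0 < x → s.eval x ≤ p.eval x) : s.natDegree ≤ p.natDegree := by
  by_contra! hlt
  have key : ∀ q : ℝ[X], q.natDegree ≤ s.natDegree → (∀ x : ℝ, 0 < x → 0 ≤ q.eval x) →
      0 ≤ q.coeff s.natDegree := by
    intro q hq hq0
    have := coeff_nonneg_of_evalReal_nonneg (p := q.map Complex.ofRealHom)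
      (natDegree_map_le.trans hq) fun x hx => by
        rw [evalReal_map_ofReal]; exact_mod_cast hq0 x hx
    rw [coeff_map] at this
    exact Complex.zero_le_real.1 this
  have h1 := key s le_rfl hs
  -- If deg s > deg p, the top coefficient of p - s is minus that of s, and both are nonnegative.
  have h2 := key (p - s) ((natDegree_sub_le_of_le hlt.le le_rfl).trans (max_self _).le) fun x hx => by
    rw [eval_sub, sub_nonneg]; exact h x hx
  rw [coeff_sub, coeff_eq_zero_of_natDegree_lt hlt, zero_sub, neg_nonneg] at h2
  have h3 : s.leadingCoeff = 0 := le_antisymm h2 h1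
  rw [leadingCoeff_eq_zero.1 h3, natDegree_zero] at hlt
  omega

/-- In a sum-of-squares representation no cancellation of leading terms takes place. -/
theorem natDegree_le_of_eq_transpose_mul_self [Fintype κ] {M : Matrix ι ι ℝ[X]}
    {E O : Matrix κ ι ℝ[X]} (hM : M = Eᵀ * E + (X : ℝ[X]) • (Oᵀ * O)) {d : ℕ} {j : ι}
    (hd : (M j j).natDegree ≤ d) (r : κ) :
    (E r j).natDegree < blockSize₁ d ∧ (O r j = 0 ∨ (O r j).natDegree < blockSize₂ d) := by
  have heval : ∀ x : ℝ, (M j j).eval x =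
      ∑ r, (E r j).eval x * (E r j).eval x + x * ∑ r, (O r j).eval x * (O r j).eval x := by
    intro x
    simp [hM, Matrix.mul_apply, eval_finsetSum]
  have hE : ∀ x, (E r j).eval x * (E r j).eval x ≤ ∑ r, (E r j).eval x * (E r j).eval x :=
    fun x => Finset.single_le_sum (f := fun r => (E r j).eval x * (E r j).eval x)
      (fun _ _ => mul_self_nonneg _) (Finset.mem_univ r)
  have hO : ∀ x, (O r j).eval x * (O r j).eval x ≤ ∑ r, (O r j).eval x * (O r j).eval x :=
    fun x => Finset.single_le_sum (f := fun r => (O r j).eval x * (O r j).eval x)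
      (fun _ _ => mul_self_nonneg _) (Finset.mem_univ r)
  constructor
  · have h1 : (E r j * E r j).natDegree ≤ (M j j).natDegree := by
      refine natDegree_le_of_eval_le (fun x _ => ?_) fun x hx => ?_
      · rw [eval_mul]; exact mul_self_nonneg _
      · rw [eval_mul, heval]
        have := mul_nonneg hx.le ((mul_self_nonneg _).trans (hO x))
        linarith [hE x]
    rw [← sq, natDegree_pow] at h1
    unfold blockSize₁
    omega
  -- Zero is set apart because for d = 0 the second block is empty and no `natDegree` lies below 0.
  · refine or_iff_not_imp_left.2 fun h0 => ?_
    have h1 : (X * (O r j * O r j)).natDegree ≤ (M j j).natDegree := by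
      refine natDegree_le_of_eval_le (fun x hx => ?_) fun x hx => ?_
      · rw [eval_mul, eval_mul, eval_X]; exact mul_nonneg hx.le (mul_self_nonneg _)
      · rw [eval_mul, eval_mul, eval_X, heval]
        have := mul_le_mul_of_nonneg_left (hO x) hx.le
        linarith [(mul_self_nonneg _).trans (hE x)]
    rw [natDegree_X_mul (mul_ne_zero h0 h0), natDegree_mul h0 h0] at h1
    unfold blockSize₂
    omega

/-! ### Gram matrices in the bilinear basis -/

theorem Polynomial.Sequence.exists_eq_sum {q : Polynomial.Sequence ℝ} {k : ℕ} {p : ℝ[X]}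
    (hp : p.degree < k) : ∃ c : Fin k → ℝ, p = ∑ a, C (c a) * q a := by
  have h := q.span_degreeLT (m := k) fun i _ => by simp
  have hr : q '' Set.Iio k = Set.range fun a : Fin k => q a := by
    ext f
    simp only [Set.mem_image, Set.mem_Iio, Set.mem_range]
    exact ⟨fun ⟨i, hi, h⟩ => ⟨⟨i, hi⟩, h⟩, fun ⟨a, h⟩ => ⟨a, a.2, h⟩⟩
  rw [hr] at h
  have hp' : p ∈ Submodule.span ℝ (Set.range fun a : Fin k => q a) := by
    rw [h]; exact mem_degreeLT.2 hp
  obtain ⟨c, hc⟩ := (Submodule.mem_span_range_iff_exists_fun ℝ).1 hp'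
  exact ⟨c, by simp only [← hc, smul_eq_C_mul]⟩

theorem bilinearTrace_apply (q : Polynomial.Sequence ℝ) {k m : ℕ}
    (Y : Matrix (Fin k × Fin m) (Fin k × Fin m) ℝ) (r s : Fin m) :
    bilinearTrace q Y r s = ∑ a, ∑ b, C (Y (a, r) (b, s)) * (q b * q a) := by
  simp [bilinearTrace, partialTrace, Matrix.mul_apply, Fintype.sum_prod_type, bilinearMatrix,
    Matrix.vecMulVec_apply, Matrix.one_apply]

theorem exists_bilinearTrace_eq (q : Polynomial.Sequence ℝ) {k m : ℕ} [Fintype κ]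
    (E : Matrix κ (Fin m) ℝ[X]) (hE : ∀ r j, (E r j).degree < k) :
    ∃ Y : Matrix (Fin k × Fin m) (Fin k × Fin m) ℝ, Y.PosSemidef ∧
      bilinearTrace q Y = Eᵀ * E := by
  choose c hc using fun r j => Polynomial.Sequence.exists_eq_sum (q := q) (hE r j)
  -- A holds the coordinates of E in the basis q, so E = A (q⃗ ⊗ 1) and EᵀE depends on A only
  -- through AᵀA.
  let A : Matrix κ (Fin k × Fin m) ℝ := Matrix.of fun r p => c r p.2 p.1
  refine ⟨Aᴴ * A, posSemidef_conjTranspose_mul_self A, ?_⟩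
  ext1 i j
  rw [bilinearTrace_apply, Matrix.mul_apply]
  have : ∀ r, Eᵀ i r * E r j =
      ∑ a, ∑ b, C (c r i a) * C (c r j b) * (q b * q a) := by
    intro r
    rw [Matrix.transpose_apply, hc r i, hc r j, Finset.sum_mul_sum]
    exact Finset.sum_congr rfl fun a _ => Finset.sum_congr rfl fun b _ => by ring
  simp only [this]
  symm
  rw [Finset.sum_comm]
  refine Finset.sum_congr rfl fun a _ => ?_
  rw [Finset.sum_comm]
  refine Finset.sum_congr rfl fun b _ => ?_
  simp [Matrix.mul_apply, A, Finset.sum_mul]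

/-- The partial trace at x is the congruence (q⃗(x) ⊗ 1)ᵀ Y (q⃗(x) ⊗ 1). -/
theorem posSemidef_eval_bilinearTrace (q : Polynomial.Sequence ℝ) {k m : ℕ}
    {Y : Matrix (Fin k × Fin m) (Fin k × Fin m) ℝ} (hY : Y.PosSemidef) (x : ℝ) :
    ((bilinearTrace q Y).map (eval x)).PosSemidef := by
  convert hY.conjTranspose_mul_mul_same
    (Matrix.of fun (p : Fin k × Fin m) (s : Fin m) => if p.2 = s then (q p.1).eval x else 0) using 1
  ext i j
  rw [Matrix.map_apply, bilinearTrace_apply]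
  simp only [eval_finsetSum, eval_mul, eval_C, Matrix.mul_apply, Fintype.sum_prod_type,
    conjTranspose_apply, Matrix.of_apply, star_trivial, mul_ite, ite_mul, mul_zero, zero_mul,
    Finset.sum_ite_eq', Finset.mem_univ, if_true, Finset.sum_mul]
  rw [Finset.sum_comm]
  exact Finset.sum_congr rfl fun a _ => Finset.sum_congr rfl fun b _ => by ring

end MatrixFejerRiesz

theorem theorem1 (q : Polynomial.Sequence ℝ) (m d : ℕ)
    (M : Matrix (Fin m) (Fin m) (Polynomial ℝ)) (hM : M.IsSymm)
    (hd : ∀ i j, (M i j).natDegree ≤ d) :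
    (∀ x : ℝ, 0 ≤ x → (M.map (Polynomial.eval x)).PosSemidef) ↔
      ∃ (Y₁ : Matrix (Fin (blockSize₁ d) × Fin m) (Fin (blockSize₁ d) × Fin m) ℝ)
        (Y₂ : Matrix (Fin (blockSize₂ d) × Fin m) (Fin (blockSize₂ d) × Fin m) ℝ),
        Y₁.PosSemidef ∧ Y₂.PosSemidef ∧
          M = bilinearTrace q Y₁ + (Polynomial.X : Polynomial ℝ) • bilinearTrace q Y₂ := by
  constructor
  · intro h
    obtain ⟨κ, _, E, O, hEO⟩ := exists_eq_transpose_mul_self_add_X_smul h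
    have hdeg := fun r j => natDegree_le_of_eq_transpose_mul_self hEO (hd j j) r
    obtain ⟨Y₁, hY₁, hE⟩ := exists_bilinearTrace_eq q E fun r j =>
      (Polynomial.degree_le_natDegree).trans_lt (by exact_mod_cast (hdeg r j).1)
    obtain ⟨Y₂, hY₂, hO⟩ := exists_bilinearTrace_eq (k := blockSize₂ d) q O fun r j => by
      rcases (hdeg r j).2 with h0 | hlt
      · rw [h0, Polynomial.degree_zero]; exact WithBot.bot_lt_coe _
      · exact (Polynomial.degree_le_natDegree).trans_lt (by exact_mod_cast hlt)
    exact ⟨Y₁, Y₂, hY₁, hY₂, by rw [hE, hO]; exact hEO⟩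
  · rintro ⟨Y₁, Y₂, hY₁, hY₂, rfl⟩ x hx
    convert (posSemidef_eval_bilinearTrace q hY₁ x).add
      ((posSemidef_eval_bilinearTrace q hY₂ x).smul hx) using 1
    ext i j
    simp
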